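/- The packing chromatic number $\chi_\rho(H)$ of a graph $H$ is the smallest integer $k$ such that there is a map $c : V(H)\to\{1,\dots,k\}$ for which any two distinct vertices $u,v$ with $c(u)=c(v)=i$ satisfy $d_H(u,v)>i$, where $d_H$ is the shortest-path distance. For a graph $G$ and an integer $n\ge 1$, the generalized Sierpiński graph $S^n_G$ has vertex set $V(G)^n$, and $u=(u_1,\dots,u_n)$, $v=(v_1,\dots,v_n)$ are adjacent if and only if there is $i\in\{1,\dots,n\}$ such that $u_j=v_j$ for all $j<i$, $\{u_i,v_i\}\in E(G)$, and $u_j=v_i$, $v_j=u_i$ for all $j>i$. The paw is the graph obtained by attaching a leaf to one of the vertices of a triangle. Then $$\chi_\rho(S^1_{paw})=3,\qquad 5\le \chi_\rho(S^2_{paw})\le 6,\qquad 7\le \chi_\rho(S^3_{paw})\le 8,$$ and $7\le \chi_\rho(S^n_{paw})\le 11$ for every integer $n\ge 4$. -/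

import Mathlib

namespace SierpinskiPacking

/-- An `i`-packing in `G`: a set of vertices in which any two distinct vertices are at
shortest-path distance greater than `i`. Vertices in different components have distance `⊤`. -/
def IsPacking {V : Type*} (G : SimpleGraph V) (i : ℕ) (W : Set V) : Prop :=
  ∀ u ∈ W, ∀ v ∈ W, u ≠ v → (i : ℕ∞) < G.edist u v

/-- A `k`-packing coloring of `G`: a map from the vertices to the colors `1, …, k` such that,
for each color `i`, the set of vertices of color `i` is an `i`-packing. -/
def IsPackingColoring {V : Type*} (G : SimpleGraph V) (k : ℕ) (c : V → ℕ) : Prop :=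
  (∀ v, c v ∈ Finset.Icc 1 k) ∧ ∀ i ∈ Finset.Icc 1 k, IsPacking G i {v | c v = i}

/-- The packing chromatic number of `G`: the least `k` for which `G` has a `k`-packing coloring
(`⊤` if there is none). -/
noncomputable def packingChromaticNumber {V : Type*} (G : SimpleGraph V) : ℕ∞ :=
  ⨅ k ∈ {k : ℕ | ∃ c : V → ℕ, IsPackingColoring G k c}, (k : ℕ∞)

/-- The generalized Sierpiński graph of `G` of dimension `n`: the vertices are the words of
length `n` over the vertices of `G`, and `u`, `v` are adjacent iff
`u = w x y y … y` and `v = w y x x … x` for some word `w` and some edge `{x, y}` of `G`. -/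
def generalizedSierpinski {V : Type*} (G : SimpleGraph V) (n : ℕ) :
    SimpleGraph (Fin n → V) where
  Adj u v := ∃ i : Fin n, (∀ j, j < i → u j = v j) ∧ G.Adj (u i) (v i) ∧
    ∀ j, i < j → u j = v i ∧ v j = u i
  symm := ⟨fun _ _ ⟨i, h1, h2, h3⟩ =>
    ⟨i, fun j hj => (h1 j hj).symm, h2.symm, fun j hj => ⟨(h3 j hj).2, (h3 j hj).1⟩⟩⟩
  loopless := ⟨fun _ ⟨_, _, h, _⟩ => G.loopless.irrefl _ h⟩

/-- The paw: the triangle on `1, 2, 3` with the leaf `0` attached to the vertex `1`. -/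
def paw : SimpleGraph (Fin 4) :=
  SimpleGraph.fromEdgeSet {s(1, 2), s(2, 3), s(1, 3), s(0, 1)}

end SierpinskiPacking

namespace SierpinskiPacking

open SimpleGraph

section General

variable {V W : Type*} {G : SimpleGraph V} {H : SimpleGraph W}

theorem isPackingColoring_of_forall {k : ℕ} {c : V → ℕ} (hc : ∀ v, c v ∈ Finset.Icc 1 k)
    (h : ∀ u v, u ≠ v → c u = c v → ¬ G.edist u v ≤ c u) : IsPackingColoring G k c := by
  refine ⟨hc, fun i _ u hu v hv huv => ?_⟩
  obtain rfl : c u = i := hu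
  exact not_le.mp (h u v huv (Eq.symm hv))

theorem IsPackingColoring.not_edist_le {k : ℕ} {c : V → ℕ} (h : IsPackingColoring G k c)
    {u v : V} (huv : u ≠ v) (hc : c u = c v) : ¬ G.edist u v ≤ c u :=
  not_le.mpr (h.2 (c u) (h.1 u) u rfl v hc.symm huv)

theorem IsPackingColoring.mono {k l : ℕ} {c : V → ℕ} (h : IsPackingColoring G k c)
    (hkl : k ≤ l) : IsPackingColoring G l c := by
  refine isPackingColoring_of_forall (fun v => ?_) fun u v huv hc => h.not_edist_le huv hc
  have := Finset.mem_Icc.mp (h.1 v)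
  exact Finset.mem_Icc.mpr ⟨this.1, this.2.trans hkl⟩

theorem edist_map_le (f : G →g H) (u v : V) : H.edist (f u) (f v) ≤ G.edist u v :=
  le_iInf fun p => by simpa using (p.map f).edist_le

theorem IsPackingColoring.comp {k l : ℕ} {c : W → ℕ} (h : IsPackingColoring H k c) (f : G →g H)
    (hf : Function.Injective f) (hl : ∀ v, c (f v) ≤ l) : IsPackingColoring G l (c ∘ f) :=
  isPackingColoring_of_forall
    (fun v => Finset.mem_Icc.mpr ⟨(Finset.mem_Icc.mp (h.1 (f v))).1, hl v⟩)
    fun u v huv hc hd => h.not_edist_le (hf.ne huv) hc ((edist_map_le f u v).trans hd)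

theorem packingChromaticNumber_le {k : ℕ} {c : V → ℕ} (h : IsPackingColoring G k c) :
    packingChromaticNumber G ≤ k :=
  iInf₂_le k ⟨c, h⟩

theorem lt_packingChromaticNumber {k : ℕ} (h : ∀ c, ¬ IsPackingColoring G k c) :
    ((k + 1 : ℕ) : ℕ∞) ≤ packingChromaticNumber G := by
  refine le_iInf₂ fun l ⟨c, hc⟩ => ?_
  by_contra hl
  have : ¬ k + 1 ≤ l := fun h' => hl (by exact_mod_cast h')
  exact h c (hc.mono (by omega))

theorem edist_le_succ {k : ℕ} {u v w : V} (h : G.edist u v ≤ k) (hvw : G.Adj v w) :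
    G.edist u w ≤ (k + 1 : ℕ) := by
  refine (SimpleGraph.edist_triangle (v := v)).trans ?_
  rw [edist_eq_one_iff_adj.mpr hvw]
  push_cast
  gcongr

theorem edist_le_of_le {k l : ℕ} {u v : V} (h : G.edist u v ≤ k) (hkl : k ≤ l) :
    G.edist u v ≤ l :=
  h.trans (by exact_mod_cast hkl)

/-- Induction on the distance from a fixed vertex, extending by one edge at a time. -/
theorem edist_induction {u : V} {p : ℕ → V → Prop} (h0 : p 0 u)
    (h1 : ∀ k v, p k v → p (k + 1) v) (h2 : ∀ k v w, p k v → G.Adj v w → p (k + 1) w)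
    {k : ℕ} {v : V} (h : G.edist u v ≤ k) : p k v := by
  obtain ⟨q, hq⟩ :=
    exists_walk_of_edist_ne_top (ne_top_of_le_ne_top (ENat.natCast_ne_top k) h)
  have hqk : q.length ≤ k := by rw [← hq] at h; exact_mod_cast h
  have key : ∀ l, p l v → ∀ m, p (l + m) v := fun l hl m => by
    induction m with
    | zero => exact hl
    | succ m ih => exact h1 _ _ ih
  obtain ⟨m, rfl⟩ := Nat.exists_eq_add_of_le hqk
  refine key _ ?_ m
  clear hq h hqk key
  rw [← Walk.length_reverse]
  generalize q.reverse = r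
  induction r with
  | nil => exact h0
  | cons hvw r ih => exact h2 _ _ _ (ih h0 r.reverse) hvw.symm

end General

section Words

variable {V : Type*} {G : SimpleGraph V}

theorem generalizedSierpinski_adj_succ {n : ℕ} {u v : Fin (n + 1) → V} :
    (generalizedSierpinski G (n + 1)).Adj u v ↔
      (u 0 = v 0 ∧ (generalizedSierpinski G n).Adj (Fin.tail u) (Fin.tail v)) ∨
      (G.Adj (u 0) (v 0) ∧ (∀ j, Fin.tail u j = v 0) ∧ ∀ j, Fin.tail v j = u 0) := by
  constructor
  · rintro ⟨i, h1, h2, h3⟩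
    induction i using Fin.cases with
    | zero =>
      exact .inr ⟨h2, fun j => (h3 j.succ (Fin.succ_pos j)).1,
        fun j => (h3 j.succ (Fin.succ_pos j)).2⟩
    | succ i =>
      exact .inl ⟨h1 0 (Fin.succ_pos i), i, fun j hj => h1 j.succ (Fin.succ_lt_succ_iff.mpr hj),
        h2, fun j hj => h3 j.succ (Fin.succ_lt_succ_iff.mpr hj)⟩
  · rintro (⟨h0, i, h1, h2, h3⟩ | ⟨h1, h2, h3⟩)
    · refine ⟨i.succ, fun j hj => ?_, h2, fun j hj => ?_⟩
      · induction j using Fin.cases with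
        | zero => exact h0
        | succ j => exact h1 j (Fin.succ_lt_succ_iff.mp hj)
      · induction j using Fin.cases with
        | zero => exact absurd hj (Fin.not_lt_zero _)
        | succ j => exact h3 j (Fin.succ_lt_succ_iff.mp hj)
    · refine ⟨0, fun j hj => absurd hj (Fin.not_lt_zero _), h1, fun j hj => ?_⟩
      induction j using Fin.cases with
      | zero => exact absurd hj (lt_irrefl _)
      | succ j => exact ⟨h2 j, h3 j⟩

/-- Prefixing a letter embeds each generalized Sierpiński graph into the next one. -/
def consHom (G : SimpleGraph V) (n : ℕ) (a : V) :
    generalizedSierpinski G n →g generalizedSierpinski G (n + 1) where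
  toFun u := Fin.cons a u
  map_rel' h := generalizedSierpinski_adj_succ.mpr (.inl ⟨rfl, by simpa using h⟩)

theorem consHom_injective (n : ℕ) (a : V) : Function.Injective (consHom G n a) :=
  Fin.cons_right_injective (α := fun _ => V) a

theorem packingChromaticNumber_mono [Nonempty V] {m n : ℕ} (h : m ≤ n) :
    packingChromaticNumber (generalizedSierpinski G m) ≤
      packingChromaticNumber (generalizedSierpinski G n) := by
  induction n, h using Nat.le_induction with
  | base => exact le_rfl
  | succ n _ ih =>
    refine ih.trans (le_iInf₂ fun k ⟨c, hc⟩ => ?_)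
    let a : V := Classical.arbitrary V
    exact packingChromaticNumber_le (hc.comp (consHom G n a) (consHom_injective n a)
      fun v => (Finset.mem_Icc.mp (hc.1 _)).2)

end Words

/-- The word of length `n` over the vertices of the paw read as a number in base `4`. -/
def code : ∀ n : ℕ, (Fin n → Fin 4) → ℕ
  | 0, _ => 0
  | n + 1, u => u 0 * 4 ^ n + code n (Fin.tail u)

/-- The number whose `n` digits in base `4` are all `1`. -/
def repunit : ℕ → ℕ
  | 0 => 0
  | n + 1 => 4 ^ n + repunit n

theorem code_cons {n : ℕ} (a : Fin 4) (u : Fin n → Fin 4) :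
    code (n + 1) (Fin.cons a u) = a * 4 ^ n + code n u := rfl

theorem code_lt : ∀ {n : ℕ} (u : Fin n → Fin 4), code n u < 4 ^ n
  | 0, _ => by simp [code]
  | n + 1, u => by
    have h1 := code_lt (Fin.tail u)
    have h2 : (u 0 : ℕ) ≤ 3 := by omega
    have h3 := Nat.mul_le_mul_right (4 ^ n) h2
    rw [code, pow_succ]
    omega

theorem code_injective : ∀ n : ℕ, Function.Injective (code n)
  | 0 => fun _ _ _ => Subsingleton.elim _ _
  | n + 1 => fun u v h => by
    have hu := code_lt (Fin.tail u)
    have hv := code_lt (Fin.tail v)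
    have h4 : 0 < 4 ^ n := by positivity
    have e : ∀ w : Fin (n + 1) → Fin 4,
        code (n + 1) w = code n (Fin.tail w) + 4 ^ n * (w 0 : ℕ) := fun w => by
      rw [code]; ring
    have h0 : (u 0 : ℕ) = v 0 := by
      have := congrArg (· / 4 ^ n) h
      simpa only [e, Nat.add_mul_div_left _ _ h4, Nat.div_eq_of_lt hu, Nat.div_eq_of_lt hv,
        zero_add] using this
    have h1 : code n (Fin.tail u) = code n (Fin.tail v) := by
      rw [e, e, h0] at h
      omega
    rw [← Fin.cons_self_tail u, ← Fin.cons_self_tail v, code_injective n h1, Fin.ext h0]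

theorem exists_code_eq : ∀ {n j : ℕ}, j < 4 ^ n → ∃ u, code n u = j
  | 0, j, h => ⟨Fin.elim0, (Nat.lt_one_iff.mp h).symm⟩
  | n + 1, j, h => by
    have h4 : 0 < 4 ^ n := by positivity
    obtain ⟨u, hu⟩ := exists_code_eq (Nat.mod_lt j h4)
    refine ⟨Fin.cons ⟨j / 4 ^ n, Nat.div_lt_of_lt_mul (by rwa [pow_succ] at h)⟩ u, ?_⟩
    rw [code_cons, hu]
    exact Nat.div_add_mod' j (4 ^ n)

theorem code_const (a : Fin 4) : ∀ n : ℕ, code n (fun _ => a) = a * repunit n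
  | 0 => by simp [code, repunit]
  | n + 1 => by
    have : Fin.tail (fun _ : Fin (n + 1) => a) = fun _ => a := rfl
    rw [code, this, code_const a n, repunit, mul_add]

/-- The codes of the two ends of an edge of the Sierpiński graph of the paw. -/
theorem exists_code_of_adj : ∀ {n : ℕ} {u v : Fin n → Fin 4},
    (generalizedSierpinski paw n).Adj u v → ∃ l k q, ∃ x y : Fin 4, l + (k + 1) = n ∧ q < 4 ^ l ∧
      paw.Adj x y ∧ code n u = q * 4 ^ (k + 1) + x * 4 ^ k + y * repunit k ∧
      code n v = q * 4 ^ (k + 1) + y * 4 ^ k + x * repunit k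
  | 0, _, _, ⟨i, _⟩ => i.elim0
  | n + 1, u, v, h => by
    rcases generalizedSierpinski_adj_succ.mp h with ⟨h0, h1⟩ | ⟨h1, h2, h3⟩
    · obtain ⟨l, k, q, x, y, hn, hq, hxy, hu, hv⟩ := exists_code_of_adj h1
      have h4 : 4 ^ n = 4 ^ l * 4 ^ (k + 1) := by rw [← hn, pow_add]
      refine ⟨l + 1, k, u 0 * 4 ^ l + q, x, y, by omega, ?_, hxy, ?_, ?_⟩
      · have h2 : (u 0 : ℕ) ≤ 3 := by omega
        have h3 := Nat.mul_le_mul_right (4 ^ l) h2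
        rw [pow_succ]
        omega
      · rw [code, hu, h4]; ring
      · rw [code, hv, h4, ← h0]; ring
    · refine ⟨0, n, 0, u 0, v 0, by omega, by simp, h1, ?_, ?_⟩
      · rw [code, show Fin.tail u = fun _ => v 0 from funext h2, code_const]; ring
      · rw [code, show Fin.tail v = fun _ => u 0 from funext h3, code_const]; ring

theorem exists_adj_of_code {k : ℕ} {x y : Fin 4} (hxy : paw.Adj x y) :
    ∀ {l q : ℕ}, q < 4 ^ l → ∃ u v : Fin (l + (k + 1)) → Fin 4,
      (generalizedSierpinski paw (l + (k + 1))).Adj u v ∧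
      code _ u = q * 4 ^ (k + 1) + x * 4 ^ k + y * repunit k ∧
      code _ v = q * 4 ^ (k + 1) + y * 4 ^ k + x * repunit k
  | 0, q, hq => by
    obtain rfl : q = 0 := by simpa using hq
    rw [Nat.zero_add]
    refine ⟨Fin.cons x fun _ => y, Fin.cons y fun _ => x,
      generalizedSierpinski_adj_succ.mpr (.inr ⟨hxy, fun _ => rfl, fun _ => rfl⟩), ?_, ?_⟩ <;>
    · rw [code_cons, code_const]; ring
  | l + 1, q, hq => by
    have h4 : 0 < 4 ^ l := by positivity
    obtain ⟨u, v, h, hu, hv⟩ := exists_adj_of_code (k := k) hxy (Nat.mod_lt q h4)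
    rw [show l + 1 + (k + 1) = l + (k + 1) + 1 by omega]
    let a : Fin 4 := ⟨q / 4 ^ l, Nat.div_lt_of_lt_mul (by rwa [pow_succ] at hq)⟩
    have e : q = a * 4 ^ l + q % 4 ^ l := (Nat.div_add_mod' q (4 ^ l)).symm
    refine ⟨Fin.cons a u, Fin.cons a v, (consHom paw _ a).map_rel' h, ?_, ?_⟩
    · rw [code_cons, hu]; conv_rhs => rw [e]
      ring
    · rw [code_cons, hv]; conv_rhs => rw [e]
      ring

theorem paw_adj_iff {x y : Fin 4} : paw.Adj x y ↔
    (x, y) ∈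
      [((0 : Fin 4), (1 : Fin 4)), (1, 0), (1, 2), (2, 1), (1, 3), (3, 1), (2, 3), (3, 2)] := by
  fin_cases x <;> fin_cases y <;> simp [paw]

instance : DecidableRel paw.Adj := fun _ _ => decidable_of_iff _ paw_adj_iff.symm

/-- `force n f = f n`, written so that the kernel evaluates `n` before it unfolds `f`. -/
noncomputable def force {α : Type} (n : ℕ) (f : ℕ → α) : α :=
  n.rec (f 0) fun m _ => f (m + 1)

@[simp]
theorem force_eq {α : Type} (n : ℕ) (f : ℕ → α) : force n f = f n := by
  cases n <;> rfl

/-- The edges of the Sierpiński graph of dimension `4` of the paw, grouped into pairs `(P, s)`: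
each `i` in the bit mask `P` is the code of a vertex joined to the vertex with code `i + s`.
The first `4 * n` pairs, restricted to codes below `4 ^ n`, are the edges in dimension `n`. -/
def moves : List (ℕ × ℕ) :=
  [(0x1111111111111111111111111111111111111111111111111111111111111111, 1),
   (0x2222222222222222222222222222222222222222222222222222222222222222, 1),
   (0x2222222222222222222222222222222222222222222222222222222222222222, 2),
   (0x4444444444444444444444444444444444444444444444444444444444444444, 1),
   (0x2000200020002000200020002000200020002000200020002000200020002, 3),
   (0x40004000400040004000400040004000400040004000400040004000400040, 3),
   (0x80008000800080008000800080008000800080008000800080008000800080, 6),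
   (0x800080008000800080008000800080008000800080008000800080008000800, 3),
   (0x20000000000000002000000000000000200000000000000020, 11),
   (0x4000000000000000400000000000000040000000000000004000000, 11),
   (0x80000000000000008000000000000000800000000000000080000000, 22),
   (0x800000000000000080000000000000008000000000000000800000000000, 11),
   (0x200000, 43),
   (0x400000000000000000000000000, 43),
   (0x80000000000000000000000000000000, 86),
   (0x800000000000000000000000000000000000000000000000, 43)]

/-- The mask of all vertices joined by `ms` to a vertex in the mask `B`. -/
def spread : List (ℕ × ℕ) → ℕ → ℕ
  | [], _ => 0
  | (P, s) :: ms, B => ((B &&& P) <<< s) ||| ((B >>> s) &&& P) ||| spread ms B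

/-- The closed neighbourhood of the mask `B`. -/
noncomputable def grow (ms : List (ℕ × ℕ)) (B : ℕ) : ℕ :=
  force B fun B => B ||| spread ms B

/-- The code `j` is obtained from `i` by one of the pairs in `ms`. -/
def Linked (ms : List (ℕ × ℕ)) (i j : ℕ) : Prop :=
  ∃ m ∈ ms, m.1.testBit i ∧ j = i + m.2

instance (ms : List (ℕ × ℕ)) (i j : ℕ) : Decidable (Linked ms i j) :=
  inferInstanceAs (Decidable (∃ m ∈ ms, _))

theorem testBit_spread {ms : List (ℕ × ℕ)} {B j : ℕ} :
    (spread ms B).testBit j ↔ ∃ i, B.testBit i ∧ (Linked ms i j ∨ Linked ms j i) := by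
  induction ms with
  | nil => simp [spread, Linked]
  | cons m ms ih =>
    obtain ⟨P, s⟩ := m
    simp only [spread, Nat.testBit_or, Nat.testBit_and, Nat.testBit_shiftLeft,
      Nat.testBit_shiftRight, Bool.or_eq_true, ih, Bool.and_eq_true, decide_eq_true_eq, Linked,
      List.exists_mem_cons_iff]
    constructor
    · rintro ((⟨h1, h2, h3⟩ | ⟨h1, h2⟩) | ⟨i, h1, h2⟩)
      · exact ⟨j - s, h2, .inl (.inl ⟨h3, by omega⟩)⟩
      · exact ⟨s + j, h1, .inr (.inl ⟨h2, by omega⟩)⟩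
      · exact ⟨i, h1, h2.imp .inr .inr⟩
    · rintro ⟨i, h1, (⟨h2, rfl⟩ | h2) | (⟨h2, rfl⟩ | h2)⟩
      · exact .inl (.inl ⟨by omega, by simpa using h1, by simpa using h2⟩)
      · exact .inr ⟨i, h1, .inl h2⟩
      · exact .inl (.inr ⟨by rwa [add_comm], h2⟩)
      · exact .inr ⟨i, h1, .inr h2⟩

theorem testBit_grow {ms : List (ℕ × ℕ)} {B j : ℕ} :
    (grow ms B).testBit j ↔
      B.testBit j ∨ ∃ i, B.testBit i ∧ (Linked ms i j ∨ Linked ms j i) := by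
  rw [grow, force_eq, Nat.testBit_or, Bool.or_eq_true, testBit_spread]

theorem exists_adj_of_linked_check : ∀ n < 4, ∀ m ∈ moves.take (4 * n), ∀ i < 4 ^ n,
    m.1.testBit i → ∃ k ∈ List.range n, ∃ q ∈ List.range (4 ^ (n - 1 - k)), ∃ x y : Fin 4,
      paw.Adj x y ∧
      i = q * 4 ^ (k + 1) + x * 4 ^ k + y * repunit k ∧
      i + m.2 = q * 4 ^ (k + 1) + y * 4 ^ k + x * repunit k := by
  decide +kernel

theorem linked_of_adj_check : ∀ k < 4, ∀ q < 4 ^ (3 - k), ∀ x y : Fin 4, paw.Adj x y →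
    Linked moves (q * 4 ^ (k + 1) + x * 4 ^ k + y * repunit k)
      (q * 4 ^ (k + 1) + y * 4 ^ k + x * repunit k) ∨
    Linked moves (q * 4 ^ (k + 1) + y * 4 ^ k + x * repunit k)
      (q * 4 ^ (k + 1) + x * 4 ^ k + y * repunit k) := by
  decide +kernel

theorem exists_adj_of_linked {n i j : ℕ} (hn : n < 4) (hi : i < 4 ^ n)
    (h : Linked (moves.take (4 * n)) i j) : ∃ u v : Fin n → Fin 4,
      (generalizedSierpinski paw n).Adj u v ∧ code n u = i ∧ code n v = j := by
  obtain ⟨m, hm, hP, rfl⟩ := h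
  obtain ⟨k, hk, q, hq, x, y, hxy, h1, h2⟩ := exists_adj_of_linked_check n hn m hm i hi hP
  rw [List.mem_range] at hk hq
  obtain ⟨l, rfl⟩ : ∃ l, n = l + (k + 1) := ⟨n - 1 - k, by omega⟩
  obtain ⟨u, v, huv, hu, hv⟩ := exists_adj_of_code (k := k) hxy (l := l) (q := q)
    (by rwa [show l + (k + 1) - 1 - k = l by omega] at hq)
  exact ⟨u, v, huv, hu.trans h1.symm, hv.trans h2.symm⟩

theorem linked_of_adj {u v : Fin 4 → Fin 4} (h : (generalizedSierpinski paw 4).Adj u v) :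
    Linked moves (code 4 u) (code 4 v) ∨ Linked moves (code 4 v) (code 4 u) := by
  obtain ⟨l, k, q, x, y, hn, hq, hxy, hu, hv⟩ := exists_code_of_adj h
  rw [hu, hv]
  exact linked_of_adj_check k (by omega) q (by rwa [show 3 - k = l by omega]) x y hxy

theorem testBit_grow_iterate_of_edist_le {u v : Fin 4 → Fin 4} {k : ℕ}
    (h : (generalizedSierpinski paw 4).edist u v ≤ k) :
    ((grow moves)^[k] (2 ^ code 4 u)).testBit (code 4 v) := by
  refine edist_induction (p := fun k v => ((grow moves)^[k] (2 ^ code 4 u)).testBit (code 4 v))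
    Nat.testBit_two_pow_self (fun k v h => ?_) (fun k v w h hvw => ?_) h
  · rw [Function.iterate_succ_apply']
    exact testBit_grow.mpr (.inl h)
  · rw [Function.iterate_succ_apply']
    exact testBit_grow.mpr (.inr ⟨_, h, linked_of_adj hvw⟩)

theorem edist_le_of_testBit_grow_iterate {n : ℕ} (hn : n < 4) (u : Fin n → Fin 4) :
    ∀ {k j : ℕ}, ((grow (moves.take (4 * n)))^[k] (2 ^ code n u)).testBit j →
      ∃ v, code n v = j ∧ (generalizedSierpinski paw n).edist u v ≤ k
  | 0, j, h => ⟨u, by simpa [Nat.testBit_two_pow] using h, by simp⟩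
  | k + 1, j, h => by
    rw [Function.iterate_succ_apply', testBit_grow] at h
    rcases h with h | ⟨i, h, hij⟩
    · obtain ⟨v, hv, huv⟩ := edist_le_of_testBit_grow_iterate hn u h
      exact ⟨v, hv, edist_le_of_le huv k.le_succ⟩
    · obtain ⟨v, rfl, huv⟩ := edist_le_of_testBit_grow_iterate hn u h
      obtain ⟨w, hvw, hw⟩ : ∃ w, (generalizedSierpinski paw n).Adj v w ∧ code n w = j := by
        rcases hij with hij | hij
        · obtain ⟨a, b, hab, ha, hb⟩ := exists_adj_of_linked hn (code_lt v) hij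
          exact ⟨b, code_injective n ha ▸ hab, hb⟩
        · have hj : j < 4 ^ n := by
            obtain ⟨m, -, -, h'⟩ := hij
            have := code_lt v
            omega
          obtain ⟨a, b, hab, ha, hb⟩ := exists_adj_of_linked hn hj hij
          exact ⟨a, code_injective n hb ▸ hab.symm, ha⟩
      exact ⟨w, hw, edist_le_succ huv hvw⟩

/-- Bit `64 * c + j` of a state says that the vertex with code `j` does not have the color `c`.
The result is the mask of the vertices that have none of the colors `1, …, K`. -/
def uncolorable (F K : ℕ) : ℕ :=
  K.rec (2 ^ 64 - 1) fun c r => r &&& (F >>> (64 * (c + 1)))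

/-- Backtracking search: each entry of the table is a vertex, as a list with one pair `(i, P)` for
each color, where `i` is the bit of the vertex and the color, and `P` the mask of the bits that
become set when the vertex gets the color. The value is `true` if every branch gets stuck. -/
noncomputable def refutes (K : ℕ) (T : List (List (ℕ × ℕ))) : ℕ → Bool :=
  T.rec (fun F => !(uncolorable F K).beq 0) fun e _ ih F =>
    !(uncolorable F K).beq 0 || e.rec true fun p _ r => (F.testBit p.1 || ih (F ||| p.2)) && r

/-- The search table of the Sierpiński graph of dimension `n` for the given branching order. -/
noncomputable def conflictTable (n K : ℕ) (order : List ℕ) : List (List (ℕ × ℕ)) :=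
  order.map fun v => (List.range' 1 K).map fun c =>
    (64 * c + v, ((grow (moves.take (4 * n)))^[c] (2 ^ v) ^^^ 2 ^ v) <<< (64 * c))

/-- A branching order for dimension `3`. -/
def branchingOrder : List ℕ :=
  [29, 30, 23, 27, 25, 22, 26, 31, 21, 53, 54, 55, 37, 39, 38, 45, 57, 47, 58, 61, 62,
    59, 46, 42]

/-- The table `conflictTable 3 6 branchingOrder`, evaluated. -/
def evaluatedTable : List (List (ℕ × ℕ)) :=
  [[(93, 0xd08000000000000000000000), (157, 0x200000d8e0000000000000000000000000000000000000),
    (221, 0xf00000def00000000000000000000000000000000000000000000000000000),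
    (285, 0x22f20020dff200000000000000000000000000000000000000000000000000000000000000000000),
    (349, 0xffff00f0dfff000000000000000000000000000000000000000000000000000000000000000000000000000000000000),
    (413, 0xffffa2f2dfff0020000000000000000000000000000000000000000000000000000000000000000000000000000000000000000000000000)],
   [(94, 0xa80000000000000000000000), (158, 0x200000be80000000000000000000000000000000000000),
    (222, 0xf00020bfe00000000000000000000000000000000000000000000000000000),
    (286, 0x22f200f0bff000000000000000000000000000000000000000000000000000000000000000000000),
    (350, 0xffff22f2bff2000000000000000000000000000000000000000000000000000000000000000000000000000000000000),
    (414, 0xffffffffbfff0000000000000000000000000000000000000000000000000000000000000000000000000000000000000000000000000000)],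
   [(87, 0x206000000000000000000000), (151, 0xf270000000000000000000000000000000000000),
    (215, 0x200000ff720000000000000000000000000000000000000000000000000000),
    (279, 0xf00020ff7f00000000000000000000000000000000000000000000000000000000000000000000),
    (343, 0x22f200f0ff7f002000000000000000000000000000000000000000000000000000000000000000000000000000000000),
    (407, 0xffff22f2ff7f00f0000000000000000000000000000000000000000000000000000000000000000000000000000000000000000000000000)],
   [(91, 0x460000000000000000000000), (155, 0x20e740000000000000000000000000000000000000),
    (219, 0x2000f0f7e00000000000000000000000000000000000000000000000000000),
    (283, 0xf022f2f7f000000000000000000000000000000000000000000000000000000000000000000000),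
    (347, 0x22f2fffff7f2000000000000000000000000000000000000000000000000000000000000000000000000000000000000),
    (411, 0xfffffffff7ff0000000000000000000000000000000000000000000000000000000000000000000000000000000000000000000000000000)],
   [(89, 0xd4000000000000000000000), (153, 0x204de0000000000000000000000000000000000000),
    (217, 0xf0edf00000000000000000000000000000000000000000000000000000),
    (281, 0x2022f2fdf200000000000000000000000000000000000000000000000000000000000000000000),
    (345, 0xf0fffffdff000000000000000000000000000000000000000000000000000000000000000000000000000000000000),
    (409, 0x26f2fffffdff0020000000000000000000000000000000000000000000000000000000000000000000000000000000000000000000000000)],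
   [(86, 0x2a000000000000000000000), (150, 0x2fb0000000000000000000000000000000000000),
    (214, 0x20ffb20000000000000000000000000000000000000000000000000000),
    (278, 0x2000f0ffbf00000000000000000000000000000000000000000000000000000000000000000000),
    (342, 0xf022f2ffbf002000000000000000000000000000000000000000000000000000000000000000000000000000000000),
    (406, 0x22f2ffffffbf00f0000000000000000000000000000000000000000000000000000000000000000000000000000000000000000000000000)],
   [(90, 0x200a0000000000000000000000), (154, 0xf04b40000000000000000000000000000000000000),
    (218, 0x22f2ebe00000000000000000000000000000000000000000000000000000),
    (282, 0x20fffffbf000000000000000000000000000000000000000000000000000000000000000000000),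
    (346, 0x4f0fffffbf2000000000000000000000000000000000000000000000000000000000000000000000000000000000000),
    (410, 0x2ef2fffffbff0000000000000000000000000000000000000000000000000000000000000000000000000000000000000000000000000000)],
   [(95, 0x200000600000000000000000000000), (159, 0xf000007880000000000000000000000000000000000000),
    (223, 0x22f200007ee00000000000000000000000000000000000000000000000000000),
    (287, 0xffff00207ff000000000000000000000000000000000000000000000000000000000000000000000),
    (351, 0xffff80f07ff2000000000000000000000000000000000000000000000000000000000000000000000000000000000000),
    (415, 0xffffe2f27fff0000000000000000000000000000000000000000000000000000000000000000000000000000000000000000000000000000)],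
   [(85, 0xd000000000000000000000), (149, 0x22d2000000000000000000000000000000000000),
    (213, 0xffdf0000000000000000000000000000000000000000000000000000),
    (277, 0x200020ffdf00200000000000000000000000000000000000000000000000000000000000000000),
    (341, 0xf000f0ffdf00f000000000000000000000000000000000000000000000000000000000000000000000000000000000),
    (405, 0x22f222f2ffdf22f2000000000000000000000000000000000000000000000000000000000000000000000000000000000000000000000000)],
   [(117, 0xd00000800000000000000000000000),
    (181, 0x22d20000e000000000000000000000000000000000000000),
    (245, 0xffdf0000f8800000000000000000000000000000000000000000000000000000),
    (309, 0xffdf8000fee000000000000000000000000000000000000000000000000000000000000000000000),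
    (373, 0xffdfe020fff0000000000000000000000000000000000000000000000000000000000000000000000000000000000000),
    (437, 0xffdff8f0fff20000000000000000000000000000000000000000000000000000000000000000000000000000000000000000000000000000)],
   [(118, 0x2a00000000000000000000000000000),
    (182, 0x2fb000008000000000000000000000000000000000000000),
    (246, 0xffb28000e0000000000000000000000000000000000000000000000000000000),
    (310, 0xffbfe000f88000000000000000000000000000000000000000000000000000000000000000000000),
    (374, 0xffbff880fee0000000000000000000000000000000000000000000000000000000000000000000000000000000000000),
    (438, 0xffbffee0fff00000000000000000000000000000000000000000000000000000000000000000000000000000000000000000000000000000)],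
   [(119, 0x20600000000000000000000000000000),
    (183, 0xf27000008000000000000000000000000000000000000000),
    (247, 0xff720000e0000000000000000000000000000000000000000000000000000000),
    (311, 0xff7f8000f88000000000000000000000000000000000000000000000000000000000000000000000),
    (375, 0xff7fe000fee0000000000000000000000000000000000000000000000000000000000000000000000000000000000000),
    (439, 0xff7ff8a0fff00000000000000000000000000000000000000000000000000000000000000000000000000000000000000000000000000000)],
   [(101, 0xd0040000000000000000000000), (165, 0x22d20e00000000000000000000000000000000000000),
    (229, 0xffdf4f400000000000000000000000000000000000000000000000000000),
    (293, 0x400ffdfefe000000000000000000000000000000000000000000000000000000000000000000000),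
    (357, 0xe20ffdffff0000000000000000000000000000000000000000000000000000000000000000000000000000000000000),
    (421, 0x4ff0ffdffff20000000000000000000000000000000000000000000000000000000000000000000000000000000000000000000000000000)],
   [(103, 0x2060000000000000000000000000), (167, 0xf2700400000000000000000000000000000000000000),
    (231, 0x400ff720e000000000000000000000000000000000000000000000000000000),
    (295, 0xe00ff7f4f4000000000000000000000000000000000000000000000000000000000000000000000),
    (359, 0x4f40ff7fefe0000000000000000000000000000000000000000000000000000000000000000000000000000000000000),
    (423, 0xefe0ff7ffff00000000000000000000000000000000000000000000000000000000000000000000000000000000000000000000000000000)],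
   [(102, 0x2a0000000000000000000000000), (166, 0x2fb00400000000000000000000000000000000000000),
    (230, 0xffb20e000000000000000000000000000000000000000000000000000000),
    (294, 0x400ffbf4f4000000000000000000000000000000000000000000000000000000000000000000000),
    (358, 0xe00ffbfefe0000000000000000000000000000000000000000000000000000000000000000000000000000000000000),
    (422, 0x4f60ffbffff00000000000000000000000000000000000000000000000000000000000000000000000000000000000000000000000000000)],
   [(109, 0xd080000000000000000000000000), (173, 0x400d8e00000000000000000000000000000000000000000),
    (237, 0xe00def004000000000000000000000000000000000000000000000000000000),
    (301, 0x4f40dff20e0000000000000000000000000000000000000000000000000000000000000000000000),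
    (365, 0xefe0dfff4f40000000000000000000000000000000000000000000000000000000000000000000000000000000000000),
    (429, 0xfff0dfffefe00000000000000000000000000000000000000000000000000000000000000000000000000000000000000000000000000000)],
   [(121, 0xd400000000000000000000000000000),
    (185, 0x4de080000000000000000000000000000000000000000000),
    (249, 0xedf0e00080000000000000000000000000000000000000000000000000000000),
    (313, 0xfdf2f880e00000000000000000000000000000000000000000000000000000000000000000000000),
    (377, 0xfdfffee0f880000000000000000000000000000000000000000000000000000000000000000000000000000000000000),
    (441, 0xfdfffff0fee00000000000000000000000000000000000000000000000000000000000000000000000000000000000000000000000000000)],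
   [(111, 0x4006000000000000000000000000000),
    (175, 0xe0078800000000000000000000000000000000000000000),
    (239, 0x4f407ee000000000000000000000000000000000000000000000000000000000),
    (303, 0xefe07ff0040000000000000000000000000000000000000000000000000000000000000000000000),
    (367, 0xfff07ff28e00000000000000000000000000000000000000000000000000000000000000000000000000000000000000),
    (431, 0xfff27fffef400000000000000000000000000000000000000000000000000000000000000000000000000000000000000000000000000000)],
   [(122, 0xa008000000000000000000000000000),
    (186, 0x4b40e0000000000000000000000000000000000000000000),
    (250, 0xebe0f88000000000000000000000000000000000000000000000000000000000),
    (314, 0xfbf0fee0800000000000000000000000000000000000000000000000000000000000000000000000),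
    (378, 0xfbf2fff0e400000000000000000000000000000000000000000000000000000000000000000000000000000000000000),
    (442, 0xfbfffff2fe800000000000000000000000000000000000000000000000000000000000000000000000000000000000000000000000000000)],
   [(125, 0xd0800000000000000000000000000000),
    (189, 0xd8e000000000000000000000000000000000000000000000),
    (253, 0xdef0000080000000000000000000000000000000000000000000000000000000),
    (317, 0xdff28000e00000000000000000000000000000000000000000000000000000000000000000000000),
    (381, 0xdfffe000f880000000000000000000000000000000000000000000000000000000000000000000000000000000000000),
    (445, 0xdffff880fee00000000000000000000000000000000000000000000000000000000000000000000000000000000000000000000000000000)],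
   [(126, 0xa8000000000000000000000000000000),
    (190, 0xbe8000000000000000000000000000000000000000000000),
    (254, 0xbfe0800000000000000000000000000000000000000000000000000000000000),
    (318, 0xbff0e000800000000000000000000000000000000000000000000000000000000000000000000000),
    (382, 0xbff2f880e000000000000000000000000000000000000000000000000000000000000000000000000000000000000000),
    (446, 0xbffffee0f8800000000000000000000000000000000000000000000000000000000000000000000000000000000000000000000000000000)],
   [(123, 0x46000000000000000000000000000000),
    (187, 0xe74080000000000000000000000000000000000000000000),
    (251, 0xf7e0e00000000000000000000000000000000000000000000000000000000000),
    (315, 0xf7f0f880800000000000000000000000000000000000000000000000000000000000000000000000),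
    (379, 0xf7f2fee0e000000000000000000000000000000000000000000000000000000000000000000000000000000000000000),
    (443, 0xf7fffff0fc800000000000000000000000000000000000000000000000000000000000000000000000000000000000000000000000000000)],
   [(110, 0xa800000000000000000000000000), (174, 0x400be800000000000000000000000000000000000000000),
    (238, 0xe00bfe000000000000000000000000000000000000000000000000000000000),
    (302, 0x4f40bff0040000000000000000000000000000000000000000000000000000000000000000000000),
    (366, 0xefe0bff20e00000000000000000000000000000000000000000000000000000000000000000000000000000000000000),
    (430, 0xfff0bfffcf400000000000000000000000000000000000000000000000000000000000000000000000000000000000000000000000000000)],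
   [(106, 0xa00000000000000000000000000), (170, 0x4b400000000000000000000000000000000000000000),
    (234, 0xebe000000000000000000000000000000000000000000000000000000000),
    (298, 0x400fbf0040000000000000000000000000000000000000000000000000000000000000000000000),
    (362, 0xe00fbf20e00000000000000000000000000000000000000000000000000000000000000000000000000000000000000),
    (426, 0x4f40fbff4f400000000000000000000000000000000000000000000000000000000000000000000000000000000000000000000000000000)]]

theorem conflictTable_eq : conflictTable 3 6 branchingOrder = evaluatedTable := by
  decide +kernel

theorem refutes_dim_one : refutes 2 (conflictTable 1 2 (List.range 4)) 0 = true := by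
  decide +kernel

theorem refutes_dim_two : refutes 4 (conflictTable 2 4 (List.range 16)) 0 = true := by
  decide +kernel

theorem testBit_uncolorable {F K j : ℕ} (hK : (uncolorable F K).testBit j) :
    j < 64 ∧ ∀ c, 1 ≤ c → c ≤ K → F.testBit (64 * c + j) := by
  induction K with
  | zero =>
    refine ⟨?_, fun c h1 h2 => absurd (h1.trans h2) (by omega)⟩
    have : (2 ^ 64 - 1).testBit j = true := hK
    rwa [Nat.testBit_two_pow_sub_one, decide_eq_true_eq] at this
  | succ K ih =>
    have h : (uncolorable F K &&& (F >>> (64 * (K + 1)))).testBit j = true := hK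
    rw [Nat.testBit_and, Bool.and_eq_true, Nat.testBit_shiftRight] at h
    refine ⟨(ih h.1).1, fun c h1 h2 => ?_⟩
    rcases Nat.le_succ_iff.mp h2 with h2 | rfl
    · exact (ih h.1).2 c h1 h2
    · exact h.2

section Refutation

variable {n K : ℕ} {col : (Fin n → Fin 4) → ℕ}

/-- Every bit of the state `F` is justified by the coloring `col`. -/
def Justified (n : ℕ) (col : (Fin n → Fin 4) → ℕ) (F : ℕ) : Prop :=
  ∀ c j, j < 64 → F.testBit (64 * c + j) → ∃ v, code n v = j ∧ col v ≠ c

theorem Justified.uncolorable_eq_zero {F : ℕ} (hF : Justified n col F) (hK : 1 ≤ K)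
    (hcol : ∀ v, col v ∈ Finset.Icc 1 K) : uncolorable F K = 0 := by
  by_contra h
  obtain ⟨j, hj⟩ := Nat.exists_testBit_of_ne_zero h
  obtain ⟨hj, h⟩ := testBit_uncolorable hj
  obtain ⟨v, rfl, -⟩ := hF 1 j hj (h 1 le_rfl hK)
  obtain ⟨w, hw, hwv⟩ := hF (col v) _ hj
    (h _ (Finset.mem_Icc.mp (hcol v)).1 (Finset.mem_Icc.mp (hcol v)).2)
  exact hwv (congrArg col (code_injective n hw))

theorem not_refutes {T : List (List (ℕ × ℕ))} (hK : 1 ≤ K)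
    (hcol : ∀ v, col v ∈ Finset.Icc 1 K)
    (hT : ∀ e ∈ T, ∃ v, ∃ p ∈ e, code n v < 64 ∧ p.1 = 64 * col v + code n v ∧
      Justified n col p.2) :
    ∀ {F : ℕ}, Justified n col F → refutes K T F = false := by
  induction T with
  | nil =>
    intro F hF
    change (!(uncolorable F K).beq 0) = false
    rw [hF.uncolorable_eq_zero hK hcol]
    rfl
  | cons e T ih =>
    intro F hF
    change (!(uncolorable F K).beq 0 ||
      e.rec true fun p _ r => (F.testBit p.1 || refutes K T (F ||| p.2)) && r) = false
    rw [hF.uncolorable_eq_zero hK hcol]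
    obtain ⟨⟨v, p, hp, hv, hp1, hp2⟩, hT'⟩ := List.forall_mem_cons.mp hT
    have key : (F.testBit p.1 || refutes K T (F ||| p.2)) = false := by
      rw [Bool.or_eq_false_iff]
      constructor
      · rw [Bool.eq_false_iff, hp1]
        intro h
        obtain ⟨w, hw, hwv⟩ := hF _ _ hv h
        exact hwv (congrArg col (code_injective n hw))
      · refine ih hT' fun c j hj h => ?_
        rw [Nat.testBit_or, Bool.or_eq_true] at h
        exact h.elim (hF c j hj) (hp2 c j hj)
    clear hp1 hp2 hT hT' ih
    change (List.rec true (fun p _ r => (F.testBit p.1 || refutes K T (F ||| p.2)) && r) e : Bool)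
      = false
    induction e with
    | nil => simp at hp
    | cons q e ihe =>
      change ((F.testBit q.1 || refutes K T (F ||| q.2)) &&
        (List.rec true (fun p _ r => (F.testBit p.1 || refutes K T (F ||| p.2)) && r) e : Bool))
        = false
      rcases List.mem_cons.mp hp with rfl | hp
      · rw [key]; rfl
      · rw [ihe hp, Bool.and_false]

theorem not_isPackingColoring_of_refutes (hn : n < 4) (hK : 1 ≤ K) {order : List ℕ}
    (horder : ∀ v ∈ order, v < 4 ^ n) (h : refutes K (conflictTable n K order) 0 = true) :
    ¬ IsPackingColoring (generalizedSierpinski paw n) K col := by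
  intro hcol
  have h64 : 4 ^ n ≤ 64 := Nat.pow_le_pow_right (by norm_num) (Nat.le_of_lt_succ hn)
  refine absurd (not_refutes (n := n) (col := col) hK hcol.1 ?_ ?_) (by rw [h]; decide)
  · intro e he
    obtain ⟨j, hj, rfl⟩ := List.mem_map.mp he
    obtain ⟨v, rfl⟩ := exists_code_eq (horder j hj)
    obtain ⟨h1, h2⟩ := Finset.mem_Icc.mp (hcol.1 v)
    refine ⟨v, _, List.mem_map_of_mem (a := col v) (List.mem_range'_1.mpr ⟨h1, by omega⟩),
      (code_lt v).trans_le h64, rfl, fun c j hj hb => ?_⟩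
    rw [Nat.testBit_shiftLeft, Bool.and_eq_true, decide_eq_true_eq, Nat.testBit_xor,
      Nat.testBit_two_pow] at hb
    obtain ⟨hcj, hb⟩ := hb
    by_cases hjv : code n v = 64 * c + j - 64 * col v
    · refine absurd hb ?_
      rw [← hjv]
      have : ((grow (moves.take (4 * n)))^[col v] (2 ^ code n v)).testBit (code n v) = true := by
        generalize col v = k
        induction k with
        | zero => exact Nat.testBit_two_pow_self
        | succ k ih =>
          rw [Function.iterate_succ_apply']
          exact testBit_grow.mpr (.inl ih)
      simp [this]
    · obtain ⟨w, hw, hvw⟩ := edist_le_of_testBit_grow_iterate hn v (by simpa [hjv] using hb)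
      have hw' := code_lt w
      obtain rfl : c = col v := by omega
      refine ⟨w, by omega, fun hwc => hcol.not_edist_le (u := v) (v := w) ?_ hwc.symm hvw⟩
      rintro rfl
      exact hjv hw
  · intro c j _ h0
    simp at h0

end Refutation

theorem refutes_dim_three : refutes 6 evaluatedTable 0 = true := by
  decide +kernel

theorem not_isPackingColoring_dim_one (col : (Fin 1 → Fin 4) → ℕ) :
    ¬ IsPackingColoring (generalizedSierpinski paw 1) 2 col :=
  not_isPackingColoring_of_refutes (by norm_num) (by norm_num)
    (fun _ hv => List.mem_range.mp hv) refutes_dim_one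

theorem not_isPackingColoring_dim_two (col : (Fin 2 → Fin 4) → ℕ) :
    ¬ IsPackingColoring (generalizedSierpinski paw 2) 4 col :=
  not_isPackingColoring_of_refutes (by norm_num) (by norm_num)
    (fun _ hv => List.mem_range.mp hv) refutes_dim_two

theorem not_isPackingColoring_dim_three (col : (Fin 3 → Fin 4) → ℕ) :
    ¬ IsPackingColoring (generalizedSierpinski paw 3) 6 col :=
  not_isPackingColoring_of_refutes (order := branchingOrder) (by norm_num) (by norm_num)
    (by decide) (conflictTable_eq ▸ refutes_dim_three)

/-- The colors of the `256` vertices in dimension `4`, as hexadecimal digits: digit `j`, counted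
from the lowest one, belongs to the vertex with code `j`. -/
def pattern : ℕ :=
  0x2161412131713141512131211461513125131231412151312513123141212131 +
  0xa17321316121213151214121b316124143191281215113413572241316235218 * 2 ^ 256 +
  0x418631519121413124131321a1614131143121512171312124151281316191a1 * 2 ^ 512 +
  0x1271164112319121215132171b2112361251143281211231251312314121b191 * 2 ^ 768

/-- The color of the vertex with code `j` in dimension `4`. -/
def patternColor (j : ℕ) : ℕ := (pattern >>> (4 * j)) % 16

/-- The mask of the codes below `N` that have the color `c`. -/
def colorClass (c : ℕ) : ℕ → ℕ
  | 0 => 0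
  | N + 1 => colorClass c N ||| if patternColor N = c then 2 ^ N else 0

theorem testBit_colorClass {c N j : ℕ} (hj : j < N) :
    (colorClass c N).testBit j ↔ patternColor j = c := by
  have key : ∀ N, (colorClass c N).testBit j ↔ j < N ∧ patternColor j = c := fun N => by
    induction N with
    | zero => simp [colorClass]
    | succ N ih =>
      rw [colorClass, Nat.testBit_or, Bool.or_eq_true, ih]
      split_ifs with h
      · rw [Nat.testBit_two_pow, decide_eq_true_eq]
        constructor
        · rintro (h' | rfl)
          · exact ⟨by omega, h'.2⟩
          · exact ⟨by omega, h⟩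
        · rintro ⟨h1, h2⟩
          by_cases h3 : j < N
          · exact .inl ⟨h3, h2⟩
          · exact .inr (by omega)
      · rw [Nat.zero_testBit]
        constructor
        · rintro (h' | h')
          · exact ⟨by omega, h'.2⟩
          · cases h'
        · rintro ⟨h1, h2⟩
          refine .inl ⟨?_, h2⟩
          rcases Nat.lt_succ_iff_lt_or_eq.mp h1 with h3 | rfl
          · exact h3
          · exact absurd h2 h
  rw [key, and_iff_right hj]

/-- The vertices in the mask `C` are more than `c` apart in dimension `4`. -/
noncomputable def separated (c C : ℕ) : Bool :=
  (List.range 256).all fun j => !C.testBit j || (((grow moves)^[c] (2 ^ j)) &&& C).beq (2 ^ j)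

/-- Vertices in the mask `C` lying in two copies of the graph of dimension `4` are more than `c`
apart if the copies are joined by an edge between their corners `x` and `y`. -/
noncomputable def separatedAcross (c C : ℕ) : Bool :=
  (List.range c).all fun i =>
    [((0 : Fin 4), (1 : Fin 4)), (1, 0), (1, 2), (2, 1), (1, 3), (3, 1), (2, 3), (3, 2)].all fun p =>
      (((grow moves)^[i] (2 ^ (p.1 * repunit 4))) &&& C).beq 0 ||
      (((grow moves)^[c - 1 - i] (2 ^ (p.2 * repunit 4))) &&& C).beq 0

theorem separated_check :
    ((List.range' 1 11).all fun c => force (colorClass c 256) (separated c)) = true := by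
  decide +kernel

theorem separatedAcross_check :
    ((List.range' 1 11).all fun c => force (colorClass c 256) (separatedAcross c)) = true := by
  decide +kernel

theorem corners_check : ∀ x y : Fin 4, x ≠ y →
    ((grow moves)^[10] (2 ^ (x * repunit 4))).testBit (y * repunit 4) = false := by
  decide +kernel

theorem patternColor_check : ∀ j < 256, 1 ≤ patternColor j ∧ patternColor j ≤ 11 ∧
    (j < 4 → patternColor j ≤ 3) ∧ (j < 16 → patternColor j ≤ 5) ∧
    (j < 64 → patternColor j ≤ 7) := by
  decide +kernel

section Pattern

variable {u v : Fin 4 → Fin 4} {c : ℕ}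

theorem code_lt_256 (w : Fin 4 → Fin 4) : code 4 w < 256 := code_lt w

theorem patternColor_mem {j : ℕ} (hj : j < 256) : patternColor j ∈ Finset.Icc 1 11 := by
  have := patternColor_check j hj
  exact Finset.mem_Icc.mpr ⟨this.1, this.2.1⟩

theorem not_edist_le_of_patternColor_eq (huv : u ≠ v)
    (h : patternColor (code 4 u) = patternColor (code 4 v)) :
    ¬ (generalizedSierpinski paw 4).edist u v ≤ patternColor (code 4 u) := by
  intro hd
  obtain ⟨h1, h2⟩ := Finset.mem_Icc.mp (patternColor_mem (code_lt_256 u))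
  have hc := List.all_eq_true.mp separated_check _ (List.mem_range'_1.mpr ⟨h1, by omega⟩)
  rw [force_eq] at hc
  have hs := List.all_eq_true.mp hc _ (List.mem_range.mpr (code_lt_256 u))
  rw [(testBit_colorClass (code_lt_256 u)).mpr rfl, Bool.not_true, Bool.false_or, Nat.beq_eq] at hs
  have hb := congrArg (Nat.testBit · (code 4 v)) hs
  simp only [Nat.testBit_and, testBit_grow_iterate_of_edist_le hd,
    (testBit_colorClass (code_lt_256 v)).mpr h.symm, Nat.testBit_two_pow] at hb
  exact huv (code_injective 4 (by simpa using hb))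

theorem not_edist_le_across {i : ℕ} {x y : Fin 4} (hxy : paw.Adj x y)
    (h : patternColor (code 4 u) = patternColor (code 4 v)) (hi : i < patternColor (code 4 u))
    (hx : (generalizedSierpinski paw 4).edist (fun _ => x) u ≤ i)
    (hy : (generalizedSierpinski paw 4).edist (fun _ => y) v ≤
      (patternColor (code 4 u) - 1 - i : ℕ)) : False := by
  obtain ⟨h1, h2⟩ := Finset.mem_Icc.mp (patternColor_mem (code_lt_256 u))
  have hc := List.all_eq_true.mp separatedAcross_check _ (List.mem_range'_1.mpr ⟨h1, by omega⟩)
  rw [force_eq] at hc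
  have hs := List.all_eq_true.mp hc _ (List.mem_range.mpr hi)
  have hp := List.all_eq_true.mp hs (x, y) (paw_adj_iff.mp hxy)
  rw [Bool.or_eq_true, Nat.beq_eq, Nat.beq_eq] at hp
  rw [← code_const, ← code_const] at hp
  rcases hp with hp | hp
  · have hb := congrArg (Nat.testBit · (code 4 u)) hp
    simp [Nat.testBit_and, testBit_grow_iterate_of_edist_le hx,
      (testBit_colorClass (code_lt_256 u)).mpr rfl] at hb
  · have hb := congrArg (Nat.testBit · (code 4 v)) hp
    simp [Nat.testBit_and, testBit_grow_iterate_of_edist_le hy,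
      (testBit_colorClass (code_lt_256 v)).mpr h.symm] at hb

theorem eq_of_edist_corner_le {x y : Fin 4}
    (h : (generalizedSierpinski paw 4).edist (fun _ => x) (fun _ => y) ≤ (10 : ℕ)) : x = y := by
  by_contra hxy
  have := testBit_grow_iterate_of_edist_le h
  rw [code_const, code_const, corners_check x y hxy] at this
  cases this

theorem isPackingColoring_dim_four :
    IsPackingColoring (generalizedSierpinski paw 4) 11 fun u => patternColor (code 4 u) :=
  isPackingColoring_of_forall (fun u => patternColor_mem (code_lt u))
    fun _ _ => not_edist_le_of_patternColor_eq

theorem exists_isPackingColoring_dim_three :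
    ∃ c, IsPackingColoring (generalizedSierpinski paw 3) 7 c :=
  ⟨_, isPackingColoring_dim_four.comp (consHom paw 3 0) (consHom_injective (G := paw) 3 0) fun u => by
    have h : code 4 (Fin.cons 0 u) = code 3 u := by simp [code_cons]
    have hu : code 3 u < 64 := code_lt u
    exact h ▸ (patternColor_check _ (by omega)).2.2.2.2 (h ▸ hu)⟩

theorem exists_isPackingColoring_dim_two :
    ∃ c, IsPackingColoring (generalizedSierpinski paw 2) 5 c :=
  ⟨_, isPackingColoring_dim_four.comp ((consHom paw 3 0).comp (consHom paw 2 0))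
    ((consHom_injective (G := paw) 3 0).comp (consHom_injective (G := paw) 2 0)) fun u => by
    have h : code 4 (Fin.cons 0 (Fin.cons 0 u : Fin 3 → Fin 4)) = code 2 u := by simp [code_cons]
    have hu : code 2 u < 16 := code_lt u
    exact h ▸ (patternColor_check _ (by omega)).2.2.2.1 (h ▸ hu)⟩

theorem exists_isPackingColoring_dim_one :
    ∃ c, IsPackingColoring (generalizedSierpinski paw 1) 3 c :=
  ⟨_, isPackingColoring_dim_four.comp
    (((consHom paw 3 0).comp (consHom paw 2 0)).comp (consHom paw 1 0))
    (((consHom_injective (G := paw) 3 0).comp (consHom_injective (G := paw) 2 0)).comp (consHom_injective (G := paw) 1 0))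
    fun u => by
    have h : code 4 (Fin.cons 0 (Fin.cons 0 (Fin.cons 0 u : Fin 2 → Fin 4) : Fin 3 → Fin 4)) =
      code 1 u := by simp [code_cons]
    have hu : code 1 u < 4 := code_lt u
    exact h ▸ (patternColor_check _ (by omega)).2.2.1 (h ▸ hu)⟩

end Pattern

section Copies

variable {V : Type*} {G : SimpleGraph V} {m : ℕ}

/-- The copy of the graph of dimension `4` in which a word lies. -/
def copyOf (u : Fin (m + 4) → V) : Fin m → V := fun i => u (Fin.castAdd 4 i)

/-- The position of a word in its copy of the graph of dimension `4`. -/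
def position (u : Fin (m + 4) → V) : Fin 4 → V := fun i => u (Fin.natAdd m i)

theorem eq_of_copyOf_eq_of_position_eq {u v : Fin (m + 4) → V} (h1 : copyOf u = copyOf v)
    (h2 : position u = position v) : u = v := by
  funext i
  induction i using Fin.addCases with
  | left i => exact congrFun h1 i
  | right i => exact congrFun h2 i

/-- The copies `w` and `w'` are joined by an edge from the corner `y` of `w` to the corner `x` of
`w'`. -/
def Crossing (G : SimpleGraph V) (w w' : Fin m → V) (x y : V) : Prop :=
  ∃ i, (∀ j, j < i → w j = w' j) ∧ G.Adj x y ∧ w i = x ∧ w' i = y ∧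
    ∀ j, i < j → w j = y ∧ w' j = x

theorem Crossing.symm {w w' : Fin m → V} {x y : V} (h : Crossing G w w' x y) :
    Crossing G w' w y x := by
  obtain ⟨i, h1, h2, h3, h4, h5⟩ := h
  exact ⟨i, fun j hj => (h1 j hj).symm, h2.symm, h4, h3, fun j hj => (h5 j hj).symm⟩

theorem Crossing.adj {w w' : Fin m → V} {x y : V} (h : Crossing G w w' x y) : G.Adj x y := by
  obtain ⟨_, _, h, _⟩ := h
  exact h

theorem Crossing.unique {w w₁ w₂ : Fin m → V} {x₁ x₂ y : V} (h₁ : Crossing G w w₁ x₁ y)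
    (h₂ : Crossing G w w₂ x₂ y) : w₁ = w₂ ∧ x₁ = x₂ := by
  obtain ⟨i, a1, a2, a3, a4, a5⟩ := h₁
  obtain ⟨j, b1, b2, b3, b4, b5⟩ := h₂
  obtain rfl : i = j := by
    rcases lt_trichotomy i j with h | h | h
    · exact absurd (b3.symm.trans (a5 j h).1) b2.ne
    · exact h
    · exact absurd (a3.symm.trans (b5 i h).1) a2.ne
  have hx : x₁ = x₂ := a3.symm.trans b3
  refine ⟨funext fun j => ?_, hx⟩
  rcases lt_trichotomy i j with h | rfl | h
  · rw [(a5 j h).2, (b5 j h).2, hx]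
  · rw [a4, b4]
  · rw [← a1 j h, ← b1 j h]

theorem copyOf_eq_or_crossing_of_adj {u v : Fin (m + 4) → V}
    (h : (generalizedSierpinski G (m + 4)).Adj u v) :
    (copyOf u = copyOf v ∧ (generalizedSierpinski G 4).Adj (position u) (position v)) ∨
    ∃ x y, Crossing G (copyOf u) (copyOf v) x y ∧ (position u = fun _ => y) ∧
      position v = fun _ => x := by
  obtain ⟨i, h1, h2, h3⟩ := h
  induction i using Fin.addCases with
  | left i =>
    have hr : ∀ j : Fin 4, Fin.castAdd 4 i < Fin.natAdd m j := fun j =>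
      Fin.lt_def.mpr (by have := i.2; simp; omega)
    exact .inr ⟨_, _, ⟨i, fun j hj => h1 _ hj, h2, rfl, rfl, fun j hj => h3 _ hj⟩,
      funext fun j => (h3 _ (hr j)).1, funext fun j => (h3 _ (hr j)).2⟩
  | right i =>
    have hl : ∀ j : Fin m, Fin.castAdd 4 j < Fin.natAdd m i := fun j =>
      Fin.lt_def.mpr (by have := j.2; simp; omega)
    exact .inl ⟨funext fun j => h1 _ (hl j), i,
      fun j hj => h1 _ (Fin.lt_def.mpr (by simpa using hj)), h2,
      fun j hj => h3 _ (Fin.lt_def.mpr (by simpa using hj))⟩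

/-- Two vertices at distance at most `11` lie in the same copy of the graph of dimension `4` or
in two adjacent ones, and their distance is measured along the obvious walks. -/
theorem copyOf_eq_or_crossing_of_edist_le {u v : Fin (m + 4) → Fin 4} {k : ℕ} (hk : k ≤ 11)
    (h : (generalizedSierpinski paw (m + 4)).edist u v ≤ k) :
    (copyOf u = copyOf v ∧ (generalizedSierpinski paw 4).edist (position u) (position v) ≤ k) ∨
    ∃ x y i j, Crossing paw (copyOf u) (copyOf v) x y ∧ i + 1 + j ≤ k ∧
      (generalizedSierpinski paw 4).edist (position u) (fun _ => y) ≤ (i : ℕ) ∧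
      (generalizedSierpinski paw 4).edist (fun _ => x) (position v) ≤ (j : ℕ) := by
  revert hk
  refine edist_induction (p := fun k v => k ≤ 11 →
    (copyOf u = copyOf v ∧ (generalizedSierpinski paw 4).edist (position u) (position v) ≤ k) ∨
    ∃ x y i j, Crossing paw (copyOf u) (copyOf v) x y ∧ i + 1 + j ≤ k ∧
      (generalizedSierpinski paw 4).edist (position u) (fun _ => y) ≤ (i : ℕ) ∧
      (generalizedSierpinski paw 4).edist (fun _ => x) (position v) ≤ (j : ℕ))
    (fun _ => .inl ⟨rfl, by simp⟩) (fun k v hv hk => ?_) (fun k v w hv hvw hk => ?_) h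
  · rcases hv (by omega) with ⟨h1, h2⟩ | ⟨x, y, i, j, h1, h2, h3⟩
    · exact .inl ⟨h1, edist_le_of_le h2 k.le_succ⟩
    · exact .inr ⟨x, y, i, j, h1, by omega, h3⟩
  · rcases hv (by omega) with ⟨h1, h2⟩ | ⟨x, y, i, j, h1, h2, h3, h4⟩
    · rcases copyOf_eq_or_crossing_of_adj hvw with ⟨g1, g2⟩ | ⟨x, y, g1, g2, g3⟩
      · exact .inl ⟨h1.trans g1, edist_le_succ h2 g2⟩
      · exact .inr ⟨x, y, k, 0, h1 ▸ g1, by omega, g2 ▸ h2, by simp [g3]⟩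
    · rcases copyOf_eq_or_crossing_of_adj hvw with ⟨g1, g2⟩ | ⟨x', y', g1, g2, g3⟩
      · exact .inr ⟨x, y, i, j + 1, g1 ▸ h1, by omega, h3, edist_le_succ h4 g2⟩
      · obtain rfl : x = y' := eq_of_edist_corner_le (edist_le_of_le (g2 ▸ h4) (by omega))
        obtain ⟨g4, rfl⟩ := h1.symm.unique g1
        exact .inl ⟨g4, g3 ▸ edist_le_of_le h3 (by omega)⟩

end Copies

theorem isPackingColoring_add_four (m : ℕ) :
    IsPackingColoring (generalizedSierpinski paw (m + 4)) 11
      fun u => patternColor (code 4 (position u)) := by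
  refine isPackingColoring_of_forall (fun u => patternColor_mem (code_lt _))
    fun u v huv hc hd => ?_
  have h11 := (Finset.mem_Icc.mp (patternColor_mem (code_lt (position u)))).2
  rcases copyOf_eq_or_crossing_of_edist_le h11 hd with ⟨h1, h2⟩ | ⟨x, y, i, j, h1, h2, h3, h4⟩
  · exact not_edist_le_of_patternColor_eq
      (fun h => huv (eq_of_copyOf_eq_of_position_eq h1 h)) hc h2
  · exact not_edist_le_across h1.adj.symm hc (by omega) (edist_comm.trans_le h3)
      (edist_le_of_le h4 (by omega))

end SierpinskiPacking

theorem mainTheorem8 :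
    SierpinskiPacking.packingChromaticNumber
        (SierpinskiPacking.generalizedSierpinski SierpinskiPacking.paw 1) = 3 ∧
    (5 ≤ SierpinskiPacking.packingChromaticNumber
        (SierpinskiPacking.generalizedSierpinski SierpinskiPacking.paw 2) ∧
      SierpinskiPacking.packingChromaticNumber
        (SierpinskiPacking.generalizedSierpinski SierpinskiPacking.paw 2) ≤ 6) ∧
    (7 ≤ SierpinskiPacking.packingChromaticNumber
        (SierpinskiPacking.generalizedSierpinski SierpinskiPacking.paw 3) ∧
      SierpinskiPacking.packingChromaticNumber
        (SierpinskiPacking.generalizedSierpinski SierpinskiPacking.paw 3) ≤ 8) ∧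
    ∀ n : ℕ, 4 ≤ n →
      7 ≤ SierpinskiPacking.packingChromaticNumber
          (SierpinskiPacking.generalizedSierpinski SierpinskiPacking.paw n) ∧
        SierpinskiPacking.packingChromaticNumber
          (SierpinskiPacking.generalizedSierpinski SierpinskiPacking.paw n) ≤ 11 := by
  open SierpinskiPacking in
  obtain ⟨_, h1⟩ := exists_isPackingColoring_dim_one
  obtain ⟨_, h2⟩ := exists_isPackingColoring_dim_two
  obtain ⟨_, h3⟩ := exists_isPackingColoring_dim_three
  have l3 : 7 ≤ packingChromaticNumber (generalizedSierpinski paw 3) :=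
    lt_packingChromaticNumber not_isPackingColoring_dim_three
  refine ⟨le_antisymm (packingChromaticNumber_le h1)
      (lt_packingChromaticNumber not_isPackingColoring_dim_one),
    ⟨lt_packingChromaticNumber not_isPackingColoring_dim_two,
      packingChromaticNumber_le (h2.mono (by norm_num))⟩,
    ⟨l3, packingChromaticNumber_le (h3.mono (by norm_num))⟩, fun n hn => ⟨?_, ?_⟩⟩
  · exact l3.trans (packingChromaticNumber_mono (by omega))
  · obtain ⟨m, rfl⟩ := Nat.exists_eq_add_of_le' hn
    exact packingChromaticNumber_le (isPackingColoring_add_four m)
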